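/- Let $X$ be a $T_1$-space and let $\tau$ be an infinite cardinal. The following assertions are equivalent: 1. $X$ is paracompact (that is, $X$ is Hausdorff and every open cover of $X$ has a locally finite open refinement) and $l(c\omega(X))\le\tau$. 2. For every lower semi-continuous closed-valued mapping $\theta:X\to Y$ into a complete metric space $Y$ there exist an upper semi-continuous compact-valued selection $\psi:X\to Y$ of $\theta$ and a closed $G_\delta$-subset $H$ of $X$ such that $c\omega(X)\subseteq H$, $w(\psi(H))\le\tau$, and $\psi(x)$ is a one-point set for every $x\in X\setminus H$. 3. For every lower semi-continuous closed-valued mapping $\theta:X\to Y$ into a complete metric space $Y$ there exists an upper semi-continuous compact-valued selection $\psi:X\to Y$ of $\theta$ such that $w(\psi^\infty(x))\le\tau$ for every $x\in X$. 4. For every lower semi-continuous mapping $\theta:X\to Y$ into a discrete space $Y$ there exists an upper semi-continuous selection $\psi:X\to Y$ of $\theta$ such that $|\psi^\infty(x)|\le\tau$ for every $x\in X$. Here all mappings are set-valued: $\theta:X\to Y$ assigns to every $x\in X$ a non-empty subset $\theta(x)\subseteq Y$, and $\psi$ is a selection of $\theta$ if $\psi(x)\subseteq\theta(x)$ for all $x$.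 For $A\subseteq X$ and $B\subseteq Y$ put $\theta(A)=\bigcup_{x\in A}\theta(x)$ and $\theta^{-1}(B)=\{x\in X:\theta(x)\cap B\ne\emptyset\}$; $\theta$ is lower (upper) semi-continuous if $\theta^{-1}(B)$ is open (closed) in $X$ for every open (closed) $B\subseteq Y$. Further, $\theta^1(A)=\theta(A)$, $\theta^{n+1}(A)=\theta(\theta^{-1}(\theta^n(A)))$, $\theta^\infty(A)=\bigcup_{n\ge1}\theta^n(A)$ and $\theta^\infty(x)=\theta^\infty(\{x\})$. The Lindelöf number $l(Z)$ is the least cardinal $m$ such that every open cover of $Z$ has an open refinement (again covering $Z$) of cardinality at most $m$; the weight $w(Z)$ is the least cardinality of a base of $Z$; subsets carry the subspace topology. Finally, $c\omega(X)=X\setminus\omega(X)$, where $\omega(X)$ is the union of all open sets $U\subseteq X$ with $\dim U=0$, and $\dim$ is the (Lebesgue) covering dimension defined by finite open covers: $\dim U=0$ means that $U\neq\emptyset$ and every finite open cover of $U$ has a finite pairwise disjoint open refinement covering $U$. -/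

import Mathlib

open Set Topology
open scoped Cardinal

universe u v

namespace SelectionTheory

/-- The weight `w(X)`: the least cardinality of a base of the topology of `X`. -/
noncomputable def weight (X : Type u) [TopologicalSpace X] : Cardinal.{u} :=
  sInf {κ | ∃ B : Set (Set X), TopologicalSpace.IsTopologicalBasis B ∧ #B = κ}

/-- `𝒰` is an open cover of the space `X`. -/
def IsOpenCover {X : Type u} [TopologicalSpace X] (𝒰 : Set (Set X)) : Prop :=
  (∀ U ∈ 𝒰, IsOpen U) ∧ ⋃₀ 𝒰 = univ

/-- Every member of `𝒱` is contained in some member of `𝒰`. -/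
def Refines {X : Type u} (𝒱 𝒰 : Set (Set X)) : Prop :=
  ∀ V ∈ 𝒱, ∃ U ∈ 𝒰, V ⊆ U

/-- The Lindelöf number `l(X)`: the least cardinal `κ` such that every open cover of `X` has an
open refinement (covering `X`) of cardinality at most `κ`. -/
noncomputable def lindelofNumber (X : Type u) [TopologicalSpace X] : Cardinal.{u} :=
  sInf {κ | ∀ 𝒰 : Set (Set X), IsOpenCover 𝒰 →
    ∃ 𝒱 : Set (Set X), IsOpenCover 𝒱 ∧ Refines 𝒱 𝒰 ∧ #𝒱 ≤ κ}

/-- `dim X ≤ n` for the (Lebesgue) covering dimension: every finite open cover of `X` has a finite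
open refinement such that every point of `X` lies in at most `n + 1` of its members. -/
def CoveringDimLE (X : Type u) [TopologicalSpace X] (n : ℕ) : Prop :=
  ∀ 𝒰 : Set (Set X), 𝒰.Finite → IsOpenCover 𝒰 →
    ∃ 𝒱 : Set (Set X), 𝒱.Finite ∧ IsOpenCover 𝒱 ∧ Refines 𝒱 𝒰 ∧
      ∀ x : X, {V ∈ 𝒱 | x ∈ V}.encard ≤ n + 1

/-- `dim X = 0`; the empty space has dimension `-1`. -/
def CoveringDimEqZero (X : Type u) [TopologicalSpace X] : Prop :=
  Nonempty X ∧ CoveringDimLE X 0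

/-- `ω(X)`: the union of all open subsets `U` of `X` with `dim U = 0`. -/
def zeroDimPart (X : Type u) [TopologicalSpace X] : Set X :=
  ⋃₀ {U : Set X | IsOpen U ∧ CoveringDimEqZero U}

/-- The cozero-dimensional kernel `cω(X) = X \ ω(X)`. -/
def cozeroDimKernel (X : Type u) [TopologicalSpace X] : Set X :=
  (zeroDimPart X)ᶜ

section SetValued

variable {X : Type u} {Y : Type v}

/-- A function into `Set Y` is a set-valued mapping when all its values are non-empty. -/
def IsSetValuedMapping (θ : X → Set Y) : Prop := ∀ x, (θ x).Nonempty

/-- The set-valued mapping `ψ` is a selection of `θ`. -/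
def IsSelection (ψ θ : X → Set Y) : Prop :=
  IsSetValuedMapping ψ ∧ ∀ x, ψ x ⊆ θ x

/-- The image `θ(A) = ⋃ {θ(x) : x ∈ A}`. -/
def setImage (θ : X → Set Y) (A : Set X) : Set Y := ⋃ x ∈ A, θ x

/-- The inverse image `θ⁻¹(B) = {x : θ(x) ∩ B ≠ ∅}`. -/
def invImage (θ : X → Set Y) (B : Set Y) : Set X := {x | (θ x ∩ B).Nonempty}

/-- `iterImage θ A n` is the `(n + 1)`-image of `A`: `θ¹(A) = θ(A)` and
`θⁿ⁺¹(A) = θ(θ⁻¹(θⁿ(A)))`. -/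
def iterImage (θ : X → Set Y) (A : Set X) : ℕ → Set Y
  | 0 => setImage θ A
  | n + 1 => setImage θ (invImage θ (iterImage θ A n))

/-- The largest image `θ^∞(A) = ⋃ₙ θⁿ(A)`. -/
def largestImage (θ : X → Set Y) (A : Set X) : Set Y := ⋃ n, iterImage θ A n

/-- Lower semi-continuity in terms of inverse images of open sets. -/
theorem lowerHemicontinuous_iff_invImage [TopologicalSpace X] [TopologicalSpace Y]
    (θ : X → Set Y) :
    LowerHemicontinuous θ ↔ ∀ G : Set Y, IsOpen G → IsOpen (invImage θ G) :=
  lowerHemicontinuous_iff_isOpen_inter_nonempty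

/-- Upper semi-continuity in terms of inverse images of closed sets. -/
theorem upperHemicontinuous_iff_invImage [TopologicalSpace X] [TopologicalSpace Y]
    (θ : X → Set Y) :
    UpperHemicontinuous θ ↔ ∀ F : Set Y, IsClosed F → IsClosed (invImage θ F) := by
  rw [upperHemicontinuous_iff_isClosed_compl_preimage_Iic_compl]
  refine forall₂_congr fun F _ => ?_
  have : (θ ⁻¹' Iic Fᶜ)ᶜ = invImage θ F := by
    ext x
    simp [invImage, Set.Nonempty, Set.subset_def]
  rw [this]

end SetValued

end SelectionTheory

/-! For 1 → 2, `ψ` is a limit of finite-valued approximations. Given an open cover of `X`, at most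
`τ` members cover `cω(X)`. Away from the kernel `X` is locally zero-dimensional, so outside some
clopen `H ⊇ cω(X)` inside their union, a member containing `x` can be chosen locally constantly. On
`H` a locally finite shrinking of the `τ` members gives finitely many choices at each point
(`exists_isApproximation_of_cover`). Doing this at scales `(1/2)^n` with decreasing `H n` and
intersecting closed balls around the approximate values gives `ψ`, with `H = ⋂ H n`.

For 2 → 3, the values off `H` are points, so a largest image lies in `ψ(H)` or is a single point.
For 3 → 4, a discrete space is completely metrizable and its cardinality is at most its weight.

For 4 → 1, the fibres of discrete selections give closure-preserving closed shrinkings, and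
Michael's theorem yields paracompactness. For the Lindelöf bound, take a discrete family of open
sets meeting `cω(X)`. Each contains a closed set and an open neighbourhood of it with no clopen set
between. A mapping built from these pairs and one extra value forces every index into a single
largest image (`mk_setOf_inter_cozeroDimKernel_le`), so there are at most `τ` of them; σ-discrete
refinements then handle arbitrary covers. -/

namespace SelectionTheory

/-! ### Closure-preserving shrinkings and Michael's paracompactness theorem -/

/-- Every open cover has a precise closure-preserving closed refinement. -/
def HasClosurePreservingShrinking (X : Type u) [TopologicalSpace X] : Prop :=
  ∀ (ι : Type u) (U : ι → Set X), (∀ i, IsOpen (U i)) → ⋃ i, U i = univ →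
    ∃ c : ι → Set X, (∀ B : Set ι, IsClosed (⋃ i ∈ B, c i)) ∧ ⋃ i, c i = univ ∧ ∀ i, c i ⊆ U i

namespace HasClosurePreservingShrinking

variable {X : Type u} [TopologicalSpace X]

theorem normalSpace (h : HasClosurePreservingShrinking X) : NormalSpace X where
  normal s t hs ht hst := by
    let U : ULift.{u} Bool → Set X := fun b => if b.down then sᶜ else tᶜ
    obtain ⟨c, hc, hcov, hsub⟩ := h (ULift Bool) U
      (by rintro ⟨b⟩; cases b <;> simp [U, hs, ht])
      (by
        refine eq_univ_of_forall fun x => ?_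
        by_cases hx : x ∈ s
        · exact mem_iUnion.2 ⟨⟨false⟩, by simpa [U] using disjoint_left.1 hst hx⟩
        · exact mem_iUnion.2 ⟨⟨true⟩, by simpa [U] using hx⟩)
    have hcl : ∀ i, IsClosed (c i) := fun i => by simpa using hc {i}
    refine ⟨(c ⟨true⟩)ᶜ, (c ⟨false⟩)ᶜ, (hcl _).isOpen_compl, (hcl _).isOpen_compl,
      fun x hx hx' => ?_, fun x hx hx' => ?_, disjoint_left.2 fun x hx hx' => ?_⟩
    · simpa [U, hx] using hsub _ hx'
    · simpa [U, hx] using hsub _ hx'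
    · obtain ⟨⟨b⟩, hb⟩ := mem_iUnion.1 (hcov.symm ▸ mem_univ x)
      cases b
      · exact hx' hb
      · exact hx hb

/-- Michael's construction of a `σ`-disjoint open refinement. -/
theorem exists_sigma_disjoint_refinement (h : HasClosurePreservingShrinking X)
    {ι : Type u} (U : ι → Set X) (hU : ∀ i, IsOpen (U i)) (hcov : ⋃ i, U i = univ) :
    ∃ V : ℕ → ι → Set X, (∀ n i, IsOpen (V n i)) ∧ (∀ n i, V n i ⊆ U i) ∧
      (∀ n i j, i ≠ j → Disjoint (V n i) (V n j)) ∧ ∀ x, ∃ n i, x ∈ V n i := by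
  obtain ⟨_, _⟩ := exists_wellFoundedLT ι
  let S := {c : ι → Set X // (∀ B : Set ι, IsClosed (⋃ i ∈ B, c i)) ∧ ⋃ i, c i = univ ∧
    ∀ i, c i ⊆ U i}
  -- Deleting from `U i` the earlier sets `c j` still leaves a cover: `x` survives in the first `U
  -- i` containing it.
  have step : ∀ c : S, ∃ d : S, ∀ i j, j < i → Disjoint (d.1 i) (c.1 j) := by
    rintro ⟨c, hc, hccov, hcU⟩
    obtain ⟨d, hd, hdcov, hdU⟩ := h ι (fun i => U i \ ⋃ j ∈ Iio i, c j)
      (fun i => (hU i).sdiff (hc _)) (by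
        refine eq_univ_of_forall fun x => ?_
        have hne : {i | x ∈ U i}.Nonempty := mem_iUnion.1 (hcov.symm ▸ mem_univ x)
        refine mem_iUnion.2 ⟨wellFounded_lt.min _ hne, wellFounded_lt.min_mem _ hne, ?_⟩
        simp only [mem_Iio, mem_iUnion, not_exists]
        exact fun j hj hx => wellFounded_lt.not_lt_min {i | x ∈ U i} (hcU j hx) hj)
    refine ⟨⟨d, hd, hdcov, fun i => (hdU i).trans sdiff_subset⟩, fun i j hji => ?_⟩
    exact disjoint_left.2 fun x hx hx' => (hdU i hx).2 (mem_biUnion (mem_Iio.2 hji) hx')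
  choose nxt hnxt using step
  obtain ⟨c₀, hc₀⟩ := h ι U hU hcov
  let C : ℕ → S := fun n => Nat.rec ⟨c₀, hc₀⟩ (fun _ c => nxt c) n
  have hC : ∀ n i j, j < i → Disjoint ((C (n + 1)).1 i) ((C n).1 j) := fun n => hnxt (C n)
  have hmem : ∀ n x, ∃ i, x ∈ (C n).1 i := fun n x =>
    mem_iUnion.1 ((C n).2.2.1.symm ▸ mem_univ x)
  -- `V n i` consists of the points that lie in the `i`-th set of stage `n` and in no other.
  refine ⟨fun n i => (⋃ j ∈ ({i}ᶜ : Set ι), (C n).1 j)ᶜ,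
    fun n i => ((C n).2.1 _).isOpen_compl, ?_, ?_, ?_⟩
  · intro n i x hx
    obtain ⟨j, hj⟩ := hmem n x
    by_cases hji : j = i
    · exact (C n).2.2.2 i (hji ▸ hj)
    · exact (hx (mem_biUnion (show j ∈ ({i}ᶜ : Set ι) from hji) hj)).elim
  · intro n i i' hne
    refine disjoint_left.2 fun x hx hx' => ?_
    obtain ⟨j, hj⟩ := hmem n x
    by_cases hji : j = i
    · exact hx' (mem_biUnion (show j ∈ ({i'}ᶜ : Set ι) from hji ▸ hne) hj)
    · exact hx (mem_biUnion (show j ∈ ({i}ᶜ : Set ι) from hji) hj)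
  · intro x
    -- All indices of `x` at stage `n + 1` are at most `m n`. Once the first index `m` attains its
    -- minimum at `k`, the only index left at stage `k + 1` is `m k`.
    let m : ℕ → ι := fun n => wellFounded_lt.min {i | x ∈ (C n).1 i} (hmem n x)
    have hm : ∀ n, x ∈ (C n).1 (m n) := fun n => wellFounded_lt.min_mem _ (hmem n x)
    have hle : ∀ n i, x ∈ (C (n + 1)).1 i → i ≤ m n := fun n i hi =>
      not_lt.1 fun hlt => disjoint_left.1 (hC n i _ hlt) hi (hm n)
    obtain ⟨k, hk⟩ : ∃ k, ∀ n, ¬ m n < m k := by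
      have hne : (range m).Nonempty := range_nonempty m
      obtain ⟨k, hk⟩ := wellFounded_lt.min_mem (range m) hne
      exact ⟨k, fun n hn => wellFounded_lt.not_lt_min (range m) (mem_range_self n) (hk ▸ hn)⟩
    refine ⟨k + 1, m k, ?_⟩
    simp only [mem_compl_iff, mem_iUnion, not_exists, mem_singleton_iff]
    intro j hj hx
    have h1 : j < m k := lt_of_le_of_ne (hle k j hx) hj
    have h2 : m (k + 1) ≤ j := not_lt.1 (wellFounded_lt.not_lt_min {i | x ∈ (C (k + 1)).1 i} hx)
    exact hk (k + 1) (h2.trans_lt h1)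

theorem exists_closed_shrinking_nat (h : HasClosurePreservingShrinking X) (U : ℕ → Set X)
    (hU : ∀ n, IsOpen (U n)) (hcov : ⋃ n, U n = univ) :
    ∃ G : ℕ → Set X, (∀ n, IsOpen (G n)) ∧ ⋃ n, G n = univ ∧ ∀ n, closure (G n) ⊆ U n := by
  have := h.normalSpace
  obtain ⟨c, hc, hccov, hcU⟩ := h (ULift ℕ) (fun n => U n.down) (fun n => hU _)
    (by rw [← hcov]; exact Equiv.ulift.surjective.iUnion_comp U)
  have hcl : ∀ i, IsClosed (c i) := fun i => by simpa using hc {i}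
  choose G hG hcG hGU using fun n : ℕ => normal_exists_closure_subset (hcl ⟨n⟩) (hU n) (hcU ⟨n⟩)
  refine ⟨G, hG, eq_univ_of_forall fun x => ?_, hGU⟩
  obtain ⟨⟨n⟩, hn⟩ := mem_iUnion.1 (hccov.symm ▸ mem_univ x)
  exact mem_iUnion.2 ⟨n, hcG n hn⟩

/-- Removing from `U n` the closures of all `G k` with `k < n` makes `G k` miss every later set. -/
theorem exists_locallyFinite_nat (h : HasClosurePreservingShrinking X) (U : ℕ → Set X)
    (hU : ∀ n, IsOpen (U n)) (hcov : ⋃ n, U n = univ) :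
    ∃ W : ℕ → Set X, (∀ n, IsOpen (W n)) ∧ ⋃ n, W n = univ ∧ LocallyFinite W ∧
      ∀ n, W n ⊆ U n := by
  obtain ⟨G, hG, hGcov, hGU⟩ := h.exists_closed_shrinking_nat U hU hcov
  refine ⟨fun n => U n \ ⋃ k ∈ Iio n, closure (G k), fun n => (hU n).sdiff
    ((finite_Iio n).isClosed_biUnion fun _ _ => isClosed_closure),
    eq_univ_of_forall fun x => ?_, fun x => ?_, fun n => sdiff_subset⟩
  · classical
    have hx : ∃ n, x ∈ U n := mem_iUnion.1 (hcov.symm ▸ mem_univ x)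
    refine mem_iUnion.2 ⟨Nat.find hx, Nat.find_spec hx, ?_⟩
    simp only [mem_Iio, mem_iUnion, not_exists]
    exact fun k hk hxk => Nat.find_min hx hk (hGU k hxk)
  · obtain ⟨k, hk⟩ := mem_iUnion.1 (hGcov.symm ▸ mem_univ x)
    refine ⟨G k, (hG k).mem_nhds hk, (finite_Iic k).subset ?_⟩
    rintro n ⟨y, hy, hyk⟩
    by_contra hn
    exact hy.2 (mem_biUnion (mem_Iio.2 (not_le.1 hn)) (subset_closure hyk))

/-- A locally finite `σ`-discrete precise open refinement. -/
theorem exists_sigma_discrete_refinement (h : HasClosurePreservingShrinking X)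
    {ι : Type u} (U : ι → Set X) (hU : ∀ i, IsOpen (U i)) (hcov : ⋃ i, U i = univ) :
    ∃ V : ℕ → ι → Set X, (∀ n i, IsOpen (V n i)) ∧ (∀ n i, V n i ⊆ U i) ∧
      (∀ n x, ∃ N ∈ 𝓝 x, {i | (V n i ∩ N).Nonempty}.Subsingleton) ∧
      (∀ x, ∃ N ∈ 𝓝 x, {n | ∃ i, (V n i ∩ N).Nonempty}.Finite) ∧ ∀ x, ∃ n i, x ∈ V n i := by
  obtain ⟨V, hV, hVU, hVd, hVcov⟩ := h.exists_sigma_disjoint_refinement U hU hcov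
  have hV' : ∀ n, IsOpen (⋃ i, V n i) := fun n => isOpen_iUnion (hV n)
  obtain ⟨W, hW, hWcov, hWlf, hWV⟩ := h.exists_locallyFinite_nat _ hV'
    (eq_univ_of_forall fun x => by simpa using hVcov x)
  obtain ⟨G, hG, hGcov, hGW⟩ := h.exists_closed_shrinking_nat W hW hWcov
  -- Disjointness becomes discreteness after cutting with `G n`, because the union of the `V n i`
  -- contains the closure of `G n`.
  refine ⟨fun n i => V n i ∩ G n, fun n i => (hV n i).inter (hG n),
    fun n i => inter_subset_left.trans (hVU n i), fun n x => ?_, fun x => ?_, fun x => ?_⟩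
  · by_cases hx : x ∈ closure (G n)
    · obtain ⟨i, hi⟩ := mem_iUnion.1 (hWV n (hGW n hx))
      refine ⟨V n i, (hV n i).mem_nhds hi, fun j hj k hk => ?_⟩
      have key : ∀ j, (V n j ∩ G n ∩ V n i).Nonempty → j = i := by
        rintro j ⟨y, hy, hyi⟩
        by_contra hne
        exact disjoint_left.1 (hVd n j i hne) hy.1 hyi
      rw [key j hj, key k hk]
    · refine ⟨(closure (G n))ᶜ, isClosed_closure.isOpen_compl.mem_nhds hx, ?_⟩
      rintro j ⟨y, hy, hyn⟩
      exact (hyn (subset_closure hy.2)).elim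
  · obtain ⟨N, hN, hfin⟩ := hWlf x
    refine ⟨N, hN, hfin.subset ?_⟩
    rintro n ⟨i, y, hy, hyN⟩
    exact ⟨y, hGW n (subset_closure hy.2), hyN⟩
  · obtain ⟨n, hn⟩ := mem_iUnion.1 (hGcov.symm ▸ mem_univ x)
    obtain ⟨i, hi⟩ := mem_iUnion.1 (hWV n (hGW n (subset_closure hn)))
    exact ⟨n, i, hi, hn⟩

theorem paracompactSpace (h : HasClosurePreservingShrinking X) : ParacompactSpace X where
  locallyFinite_refinement ι U hU hcov := by
    obtain ⟨V, hV, hVU, hd, hlf, hVcov⟩ := h.exists_sigma_discrete_refinement U hU hcov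
    refine ⟨ℕ × ι, fun p => V p.1 p.2, fun p => hV _ _,
      eq_univ_of_forall fun x => ?_, fun x => ?_, fun p => ⟨p.2, hVU _ _⟩⟩
    · obtain ⟨n, i, hx⟩ := hVcov x
      exact mem_iUnion.2 ⟨(n, i), hx⟩
    · obtain ⟨N, hN, hfin⟩ := hlf x
      choose M hM hsub using fun n => hd n x
      refine ⟨N ∩ ⋂ n ∈ {n | ∃ i, (V n i ∩ N).Nonempty}, M n,
        Filter.inter_mem hN ((Filter.biInter_mem hfin).2 fun n _ => hM n), ?_⟩
      refine (hfin.biUnion (t := fun n => Prod.mk n '' {i | (V n i ∩ M n).Nonempty})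
        fun n _ => (hsub n).finite.image _).subset ?_
      rintro ⟨n, i⟩ ⟨y, hy, hyN, hyM⟩
      have hn : n ∈ {n | ∃ i, (V n i ∩ N).Nonempty} := ⟨i, y, hy, hyN⟩
      exact mem_biUnion hn ⟨i, ⟨y, hy, mem_iInter₂.1 hyM n hn⟩, rfl⟩

end HasClosurePreservingShrinking

/-! ### Clopen separation and the cozero-dimensional kernel -/

section Dimension

variable {X : Type u} [TopologicalSpace X]

/-- Closed subsets of `W` are separated from the complement of `W` by clopen sets. -/
def ClopenSeparates (W : Set X) : Prop :=
  ∀ B : Set X, IsClosed B → B ⊆ W → ∃ K : Set X, IsClopen K ∧ B ⊆ K ∧ K ⊆ W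

/-- Separation inside `U` comes from a disjoint refinement of `{W, U \ B}`. A relatively clopen
subset of `U` that lies in a closed set `F ⊆ U` is clopen in `X`, hence the restriction to `interior
F`. -/
theorem exists_clopenSeparates_of_mem_zeroDimPart [RegularSpace X] {x : X}
    (hx : x ∈ zeroDimPart X) :
    ∃ V : Set X, IsOpen V ∧ x ∈ V ∧ V ⊆ zeroDimPart X ∧
      ∀ W ⊆ V, IsOpen W → ClopenSeparates W := by
  obtain ⟨U, ⟨hU, hdim⟩, hxU⟩ := hx
  obtain ⟨F, hF, hFc, hFU⟩ := exists_mem_nhds_isClosed_subset (hU.mem_nhds hxU)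
  refine ⟨interior F, isOpen_interior, mem_interior_iff_mem_nhds.2 hF,
    (interior_subset.trans hFU).trans (subset_sUnion_of_mem ⟨hU, hdim⟩), fun W hWF hW B hB hBW => ?_⟩
  have hWF' : W ⊆ F := hWF.trans interior_subset
  let w : Set U := Subtype.val ⁻¹' W
  let b : Set U := (Subtype.val ⁻¹' B)ᶜ
  have hw : IsOpen w := hW.preimage continuous_subtype_val
  have hb : IsOpen b := (hB.preimage continuous_subtype_val).isOpen_compl
  obtain ⟨𝒱, -, ⟨hVo, hVc⟩, hVr, hVd⟩ := hdim.2 {w, b} (by simp)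
    ⟨by rintro s (rfl | rfl) <;> assumption, by
      refine eq_univ_of_forall fun y => ?_
      by_cases hy : (y : X) ∈ B
      · exact ⟨w, by simp, hBW hy⟩
      · exact ⟨b, by simp, hy⟩⟩
  -- Each point lies in at most one member of `𝒱`, so the complement of `k` is the union of the
  -- remaining members and is open.
  let k : Set U := ⋃₀ {V ∈ 𝒱 | V ⊆ w}
  have hko : IsOpen k := isOpen_sUnion fun V hV => hVo V hV.1
  have hkc : kᶜ = ⋃₀ {V ∈ 𝒱 | ¬ V ⊆ w} := by
    ext y
    obtain ⟨V, hV, hyV⟩ : y ∈ ⋃₀ 𝒱 := hVc ▸ mem_univ y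
    constructor
    · intro hy
      exact ⟨V, ⟨hV, fun hVw => hy ⟨V, ⟨hV, hVw⟩, hyV⟩⟩, hyV⟩
    · rintro ⟨V₁, ⟨hV₁, hn⟩, hy₁⟩ ⟨V₂, ⟨hV₂, hV₂w⟩, hy₂⟩
      have hle : {V ∈ 𝒱 | y ∈ V}.encard ≤ 1 := by simpa using hVd y
      rw [encard_le_one_iff] at hle
      exact hn (hle V₁ V₂ ⟨hV₁, hy₁⟩ ⟨hV₂, hy₂⟩ ▸ hV₂w)
  have hkc' : IsOpen kᶜ := hkc ▸ isOpen_sUnion fun V hV => hVo V hV.1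
  have hkw : k ⊆ w := sUnion_subset fun V hV => hV.2
  refine ⟨Subtype.val '' k, ⟨?_, hU.isOpenMap_subtype_val _ hko⟩, fun y hy => ?_, ?_⟩
  · have heq : (Subtype.val '' k : Set X) = F \ Subtype.val '' kᶜ := by
      ext y
      constructor
      · rintro ⟨z, hz, rfl⟩
        refine ⟨hWF' (hkw hz), ?_⟩
        rintro ⟨z', hz', he⟩
        exact hz' (Subtype.ext he ▸ hz)
      · rintro ⟨hy, hy'⟩
        by_contra hn
        exact hy' ⟨⟨y, hFU hy⟩, fun hk => hn ⟨_, hk, rfl⟩, rfl⟩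
    rw [heq]
    exact hFc.sdiff (hU.isOpenMap_subtype_val _ hkc')
  · have hyU : y ∈ U := hFU (hWF' (hBW hy))
    obtain ⟨V, hV, hyV⟩ : (⟨y, hyU⟩ : U) ∈ ⋃₀ 𝒱 := hVc ▸ mem_univ _
    refine ⟨⟨y, hyU⟩, ⟨V, ⟨hV, ?_⟩, hyV⟩, rfl⟩
    obtain ⟨s, rfl | rfl, hVs⟩ := hVr V hV
    · exact hVs
    · exact (hVs hyV hy).elim
  · rintro _ ⟨z, hz, rfl⟩
    exact hkw hz

theorem isOpen_setOf_forall_mem_iff {ι : Type*} {K : ι → Set X} (hK : ∀ i, IsClopen (K i))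
    (hlf : LocallyFinite K) (x : X) : IsOpen {y | ∀ i, y ∈ K i ↔ x ∈ K i} := by
  have h1 : IsOpen (⋂ i ∈ {i | x ∈ K i}, K i) :=
    (hlf.point_finite x).isOpen_biInter fun i _ => (hK i).isOpen
  have h2 : IsClosed (⋃ i : {i | x ∉ K i}, K i) :=
    (hlf.comp_injective Subtype.val_injective).isClosed_iUnion fun i => (hK i).isClosed
  convert h1.inter h2.isOpen_compl using 1
  ext y
  simp only [mem_ofPred_eq, mem_inter_iff, mem_iInter, mem_compl_iff, mem_iUnion, not_exists,
    Subtype.forall]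
  exact ⟨fun h => ⟨fun i => (h i).2, fun i hi hy => hi ((h i).1 hy)⟩,
    fun h i => ⟨fun hy => by_contra fun hx => h.2 i hx hy, h.1 i⟩⟩

/-- A clopen `E` with `x ∈ E ⊆ O` has dimension zero: a finite open cover of `E` shrinks to a closed
cover by normality, then to a clopen one by separation, whose atoms form a disjoint open refinement.
-/
theorem mem_zeroDimPart_of_clopenSeparates [NormalSpace X] [T1Space X] {x : X} {O : Set X}
    (hO : IsOpen O) (hx : x ∈ O) (h : ∀ W ⊆ O, IsOpen W → ClopenSeparates W) :
    x ∈ zeroDimPart X := by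
  obtain ⟨E, hE, hxE, hEO⟩ := h O Subset.rfl hO {x} isClosed_singleton (singleton_subset_iff.2 hx)
  rw [singleton_subset_iff] at hxE
  refine ⟨E, ⟨hE.isOpen, ⟨⟨x, hxE⟩⟩, fun 𝒰 hfin ⟨hUo, hUc⟩ => ?_⟩, hxE⟩
  have : Finite 𝒰 := hfin
  obtain ⟨v, hEv, hvc, hvU⟩ := exists_subset_iUnion_closed_subset (s := E)
    (u := fun U : 𝒰 => (Subtype.val '' U.1 : Set X)) hE.isClosed
    (fun U => hE.isOpen.isOpenMap_subtype_val _ (hUo U.1 U.2)) (fun _ _ => toFinite _)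
    (fun y hy => by
      obtain ⟨U, hU, hyU⟩ : (⟨y, hy⟩ : E) ∈ ⋃₀ 𝒰 := hUc ▸ mem_univ _
      exact mem_iUnion.2 ⟨⟨U, hU⟩, _, hyU, rfl⟩)
  choose K hK hvK hKU using fun U : 𝒰 => h _
    ((image_subset_iff.2 fun y _ => hEO y.2 : (Subtype.val '' U.1 : Set X) ⊆ O))
    (hE.isOpen.isOpenMap_subtype_val _ (hUo U.1 U.2)) (v U) (hvc U) (hvU U)
  let A : Set 𝒰 → Set E := fun σ => {y | ∀ U, (y : X) ∈ K U ↔ U ∈ σ}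
  have hAmem : ∀ y : E, ∃ U, (y : X) ∈ K U := fun y =>
    (mem_iUnion.1 (hEv y.2)).imp fun U hU => hvK U hU
  refine ⟨range A, finite_range A, ⟨?_, ?_⟩, ?_, fun y => ?_⟩
  · rintro _ ⟨σ, rfl⟩
    refine isOpen_iff_forall_mem_open.2 fun y hy => ⟨Subtype.val ⁻¹' {z | ∀ U, z ∈ K U ↔ ↑y ∈ K U},
      fun z hz U => (hz U).trans (hy U),
      (isOpen_setOf_forall_mem_iff hK (locallyFinite_of_finite K) _).preimage
        continuous_subtype_val, fun U => Iff.rfl⟩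
  · exact eq_univ_of_forall fun y => ⟨A {U | (y : X) ∈ K U}, mem_range_self _, fun U => Iff.rfl⟩
  · rintro _ ⟨σ, rfl⟩
    by_cases hne : (A σ).Nonempty
    · obtain ⟨y, hy⟩ := hne
      obtain ⟨U, hU⟩ := hAmem y
      refine ⟨U.1, U.2, fun z hz => ?_⟩
      obtain ⟨z', hz', he⟩ := hKU U ((hz U).2 ((hy U).1 hU))
      exact Subtype.ext he ▸ hz'
    · obtain ⟨U, hU, -⟩ : (⟨x, hxE⟩ : E) ∈ ⋃₀ 𝒰 := hUc ▸ mem_univ _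
      exact ⟨U, hU, by simp [not_nonempty_iff_eq_empty.1 hne]⟩
  · have : {V ∈ range A | y ∈ V}.encard ≤ 1 := by
      rw [encard_le_one_iff]
      rintro _ _ ⟨⟨σ, rfl⟩, hσ⟩ ⟨⟨ρ, rfl⟩, hρ⟩
      congr 1
      ext U
      exact (hσ U).symm.trans (hρ U)
    simpa using this

theorem isClosed_cozeroDimKernel : IsClosed (cozeroDimKernel X) :=
  (isOpen_sUnion fun _ hU => hU.1).isClosed_compl

/-- The cozero-dimensional kernel of a paracompact Hausdorff space has a base of clopen
neighbourhoods, outside of which open covers have locally constant selections. -/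
theorem exists_isClopen_superset_cozeroDimKernel [T2Space X] [ParacompactSpace X] {ι : Type*}
    {U : ι → Set X} (hU : ∀ i, IsOpen (U i)) (hcov : ⋃ i, U i = univ) {O : Set X} (hO : IsOpen O)
    (hCO : cozeroDimKernel X ⊆ O) :
    ∃ (H : Set X) (g : X → ι), IsClopen H ∧ cozeroDimKernel X ⊆ H ∧ H ⊆ O ∧
      ∀ x ∉ H, x ∈ U (g x) ∧ ∀ᶠ y in 𝓝 x, g y = g x := by
  have hmem : ∀ x, ∃ i, x ∈ U i := fun x => mem_iUnion.1 (hcov.symm ▸ mem_univ x)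
  choose ind hind using hmem
  choose V hV hxV hVz hVs using fun x : ↥(Oᶜ) =>
    exists_clopenSeparates_of_mem_zeroDimPart (X := X) (notMem_compl_iff.1 fun h => x.2 (hCO h))
  obtain ⟨v, hvo, hOv, hvlf, hvu⟩ := precise_refinement_set hO.isClosed_compl
    (fun x : ↥(Oᶜ) => V x ∩ U (ind x)) (fun x => (hV x).inter (hU _))
    (fun x hx => mem_iUnion.2 ⟨⟨x, hx⟩, hxV ⟨x, hx⟩, hind x⟩)
  obtain ⟨b, hOb, hbc, hbv⟩ := exists_subset_iUnion_closed_subset hO.isClosed_compl hvo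
    (fun x _ => hvlf.point_finite x) hOv
  choose K hK hbK hKv using fun x => hVs x (v x) ((hvu x).trans inter_subset_left) (hvo x) (b x)
    (hbc x) (hbv x)
  have hKlf : LocallyFinite K := hvlf.subset hKv
  have hKu : IsClopen (⋃ x, K x) :=
    ⟨hKlf.isClosed_iUnion fun x => (hK x).isClosed, isOpen_iUnion fun x => (hK x).isOpen⟩
  classical
  -- Off `H` the index depends only on the set of those `K z` that contain the point, which is
  -- locally constant. The default `ind x` occurs only on `H`.
  let g' : X → Set ↥(Oᶜ) → ι := fun x σ => if hσ : σ.Nonempty then ind hσ.choose else ind x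
  refine ⟨(⋃ x, K x)ᶜ, fun x => g' x {z | x ∈ K z}, hKu.compl, ?_, ?_, fun x hx => ?_⟩
  · refine fun x hx hxK => ?_
    obtain ⟨z, hz⟩ := mem_iUnion.1 hxK
    exact hx (hVz z (hvu z (hKv z hz)).1)
  · refine fun x hx => by_contra fun hxO => hx ?_
    obtain ⟨z, hz⟩ := mem_iUnion.1 (hOb hxO)
    exact mem_iUnion.2 ⟨z, hbK z hz⟩
  · rw [notMem_compl_iff, mem_iUnion] at hx
    have hne : {z | x ∈ K z}.Nonempty := hx
    constructor
    · simp only [g', dif_pos hne]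
      exact (hvu _ (hKv _ hne.choose_spec)).2
    · filter_upwards [(isOpen_setOf_forall_mem_iff hK hKlf x).mem_nhds fun i => Iff.rfl] with y hy
      have : {z | y ∈ K z} = {z | x ∈ K z} := by ext z; exact hy z
      simp only [this, g', dif_pos hne]

end Dimension

/-! ### Lindelöf numbers and indexed covers -/

section Cardinality

theorem mk_le_of_lindelofNumber_le {Z : Type u} [TopologicalSpace Z] {τ : Cardinal.{u}}
    (h : lindelofNumber Z ≤ τ) {𝒰 : Set (Set Z)} (h𝒰 : IsOpenCover 𝒰) :
    ∃ 𝒱 : Set (Set Z), IsOpenCover 𝒱 ∧ Refines 𝒱 𝒰 ∧ #𝒱 ≤ τ := by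
  have hne : {κ : Cardinal.{u} | ∀ 𝒰 : Set (Set Z), IsOpenCover 𝒰 →
      ∃ 𝒱 : Set (Set Z), IsOpenCover 𝒱 ∧ Refines 𝒱 𝒰 ∧ #𝒱 ≤ κ}.Nonempty :=
    ⟨#(Set Z), fun 𝒰 h => ⟨𝒰, h, fun V hV => ⟨V, hV, Subset.rfl⟩, Cardinal.mk_set_le _⟩⟩
  obtain ⟨𝒱, h1, h2, h3⟩ := csInf_mem hne 𝒰 h𝒰
  exact ⟨𝒱, h1, h2, h3.trans h⟩

theorem exists_subset_iUnion_of_lindelofNumber_le {X : Type u} [TopologicalSpace X] {C : Set X}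
    {τ : Cardinal.{u}} (h : lindelofNumber C ≤ τ) {ι : Type u} {U : ι → Set X}
    (hU : ∀ i, IsOpen (U i)) (hcov : C ⊆ ⋃ i, U i) :
    ∃ J : Set ι, #J ≤ τ ∧ C ⊆ ⋃ i : J, U i := by
  obtain ⟨𝒱, h𝒱, href, hcard⟩ := mk_le_of_lindelofNumber_le h
    (𝒰 := range fun i => (Subtype.val ⁻¹' U i : Set C))
    ⟨by rintro _ ⟨i, rfl⟩; exact (hU i).preimage continuous_subtype_val,
      eq_univ_of_forall fun x => by
        obtain ⟨i, hi⟩ := mem_iUnion.1 (hcov x.2)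
        exact ⟨_, ⟨i, rfl⟩, hi⟩⟩
  have hind : ∀ V : 𝒱, ∃ i, V.1 ⊆ Subtype.val ⁻¹' U i := by
    rintro ⟨V, hV⟩
    obtain ⟨_, ⟨i, rfl⟩, hi⟩ := href V hV
    exact ⟨i, hi⟩
  choose f hf using hind
  refine ⟨range f, Cardinal.mk_range_le.trans hcard, fun x hx => ?_⟩
  obtain ⟨V, hV, hxV⟩ : (⟨x, hx⟩ : C) ∈ ⋃₀ 𝒱 := h𝒱.2 ▸ mem_univ _
  exact mem_iUnion.2 ⟨⟨f ⟨V, hV⟩, mem_range_self _⟩, hf ⟨V, hV⟩ hxV⟩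

end Cardinality

/-! ### Approximate selections of an open cover -/

section Approximation

variable {X : Type u} [TopologicalSpace X] {Y Z : Type u}

/-- A pair `m ⊆ p` of set-valued mappings into a discrete space, `m` with open fibres and `p` upper
semi-continuous and finite-valued, such that `p` is single-valued outside of a clopen set `H`
containing the cozero-dimensional kernel, and `p(H)` has cardinality at most `τ`. -/
structure IsApproximation (τ : Cardinal.{u}) (m p : X → Set Y) (H : Set X) : Prop where
  nonempty : ∀ x, (m x).Nonempty
  subset : ∀ x, m x ⊆ p x
  isOpen_fiber : ∀ y, IsOpen {x | y ∈ m x}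
  finite : ∀ x, (p x).Finite
  eventually_subset : ∀ x, ∀ᶠ x' in 𝓝 x, p x' ⊆ p x
  isClopen : IsClopen H
  kernel_subset : cozeroDimKernel X ⊆ H
  mk_le : #(⋃ x ∈ H, p x : Set Y) ≤ τ
  singleton : ∀ x ∉ H, ∃ y, p x = {y}

theorem IsApproximation.image {τ : Cardinal.{u}} {m p : X → Set Y} {H : Set X}
    (h : IsApproximation τ m p H) (f : Y → Z) :
    IsApproximation τ (fun x => f '' m x) (fun x => f '' p x) H where
  nonempty x := (h.nonempty x).image f
  subset x := image_mono (h.subset x)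
  isOpen_fiber z := by
    have : {x | z ∈ f '' m x} = ⋃ y ∈ f ⁻¹' {z}, {x | y ∈ m x} := by
      ext x; simp [and_comm]
    rw [this]
    exact isOpen_biUnion fun y _ => h.isOpen_fiber y
  finite x := (h.finite x).image f
  eventually_subset x := (h.eventually_subset x).mono fun _ hx => image_mono hx
  isClopen := h.isClopen
  kernel_subset := h.kernel_subset
  mk_le := by
    rw [← image_iUnion₂]
    exact Cardinal.mk_image_le.trans h.mk_le
  singleton x hx := by
    obtain ⟨y, hy⟩ := h.singleton x hx
    exact ⟨f y, by simp [hy]⟩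

theorem exists_isApproximation_of_cover [T2Space X] [ParacompactSpace X] {τ : Cardinal.{u}}
    (hl : lindelofNumber (cozeroDimKernel X) ≤ τ) {ι : Type u} {U : ι → Set X}
    (hU : ∀ i, IsOpen (U i)) (hcov : ⋃ i, U i = univ) {O : Set X} (hO : IsOpen O)
    (hCO : cozeroDimKernel X ⊆ O) :
    ∃ (m p : X → Set ι) (H : Set X), IsApproximation τ m p H ∧ H ⊆ O ∧
      ∀ x, ∀ i ∈ p x, x ∈ U i := by
  obtain ⟨J, hJ, hCJ⟩ := exists_subset_iUnion_of_lindelofNumber_le hl hU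
    (hcov.symm ▸ subset_univ _)
  obtain ⟨H, g, hH, hCH, hHO, hg⟩ := exists_isClopen_superset_cozeroDimKernel hU hcov
    (hO.inter (isOpen_iUnion fun j : J => hU j)) (subset_inter hCO hCJ)
  obtain ⟨v, hvo, hHv, hvlf, hvU⟩ := precise_refinement_set hH.isClosed (fun j : J => U j)
    (fun j => hU j) (hHO.trans inter_subset_right)
  obtain ⟨b, hHb, hbo, hbv⟩ := exists_subset_iUnion_closure_subset hH.isClosed hvo
    (fun x _ => hvlf.point_finite x) hHv
  have hblf : LocallyFinite fun j => closure (b j) := hvlf.subset hbv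
  classical
  -- On `H` the open sets `b j` give `m` open fibres, and their locally finite closures make `p`
  -- finite-valued and upper semi-continuous; off `H` both are the locally constant choice `g`.
  let m : X → Set ι := fun x => if x ∈ H then Subtype.val '' {j | x ∈ b j} else {g x}
  let p : X → Set ι := fun x => if x ∈ H then Subtype.val '' {j | x ∈ closure (b j)} else {g x}
  have hmH : ∀ x ∈ H, m x = Subtype.val '' {j | x ∈ b j} := fun x hx => if_pos hx
  have hpH : ∀ x ∈ H, p x = Subtype.val '' {j | x ∈ closure (b j)} := fun x hx => if_pos hx
  have hmH' : ∀ x ∉ H, m x = {g x} := fun x hx => if_neg hx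
  have hpH' : ∀ x ∉ H, p x = {g x} := fun x hx => if_neg hx
  refine ⟨m, p, H, ⟨fun x => ?_, fun x => ?_, fun i => ?_, fun x => ?_, fun x => ?_, hH, hCH, ?_,
    fun x hx => ⟨g x, hpH' x hx⟩⟩, hHO.trans inter_subset_left, fun x i hi => ?_⟩
  · by_cases hx : x ∈ H
    · rw [hmH x hx]
      obtain ⟨j, hj⟩ := mem_iUnion.1 (hHb hx)
      exact ⟨j, j, hj, rfl⟩
    · rw [hmH' x hx]
      exact singleton_nonempty _
  · by_cases hx : x ∈ H
    · rw [hmH x hx, hpH x hx]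
      exact image_mono fun j hj => subset_closure hj
    · rw [hmH' x hx, hpH' x hx]
  · rw [isOpen_iff_mem_nhds]
    intro x hi
    by_cases hx : x ∈ H
    · rw [mem_ofPred_eq, hmH x hx] at hi
      obtain ⟨j, hj, rfl⟩ := hi
      filter_upwards [hH.isOpen.mem_nhds hx, (hbo j).mem_nhds hj] with y hy hyj
      rw [hmH y hy]
      exact ⟨j, hyj, rfl⟩
    · rw [mem_ofPred_eq, hmH' x hx] at hi
      filter_upwards [hH.compl.isOpen.mem_nhds hx, (hg x hx).2] with y hy hgy
      rw [hmH' y hy, hgy]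
      exact hi
  · by_cases hx : x ∈ H
    · rw [hpH x hx]
      exact (hblf.point_finite x).image _
    · rw [hpH' x hx]
      exact finite_singleton _
  · by_cases hx : x ∈ H
    · filter_upwards [hH.isOpen.mem_nhds hx,
        hblf.iInter_compl_mem_nhds (fun _ => isClosed_closure) x] with y hy hyc
      rw [hpH x hx, hpH y hy]
      refine image_mono fun j hj => by_contra fun hn => ?_
      exact mem_iInter₂.1 hyc j hn hj
    · filter_upwards [hH.compl.isOpen.mem_nhds hx, (hg x hx).2] with y hy hgy
      rw [hpH' x hx, hpH' y hy, hgy]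
  · refine (Cardinal.mk_le_mk_of_subset (iUnion₂_subset fun x hx => ?_)).trans hJ
    rw [hpH x hx]
    rintro _ ⟨j, -, rfl⟩
    exact j.2
  · by_cases hx : x ∈ H
    · rw [hpH x hx] at hi
      obtain ⟨j, hj, rfl⟩ := hi
      exact hvU j (hbv j hj)
    · rw [hpH' x hx] at hi
      rw [mem_singleton_iff.1 hi]
      exact (hg x hx).1

end Approximation

/-! ### Limits of finite approximations in a complete metric space -/

section Limit

variable {Y : Type u} [MetricSpace Y]

/-- The union of the closed balls of radius `2 * (1/2)^n` around the points of `S n`. -/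
def ballHull (S : ℕ → Set Y) (n : ℕ) : Set Y := ⋃ s ∈ S n, Metric.closedBall s (2 * (1 / 2) ^ n)

theorem isClosed_ballHull {S : ℕ → Set Y} (hS : ∀ n, (S n).Finite) (n : ℕ) :
    IsClosed (ballHull S n) :=
  (hS n).isClosed_biUnion fun _ _ => Metric.isClosed_closedBall

/-- The radius is the tail sum of the step sizes: `(1/2)^n + 2 * (1/2)^(n+1) = 2 * (1/2)^n`. -/
theorem antitone_ballHull {S : ℕ → Set Y}
    (hS : ∀ n, ∀ y ∈ S (n + 1), ∃ s ∈ S n, dist y s ≤ (1 / 2) ^ n) : Antitone (ballHull S) := by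
  refine antitone_nat_of_succ_le fun n y hy => ?_
  obtain ⟨t, ht, hyt⟩ := mem_iUnion₂.1 hy
  obtain ⟨s, hs, hts⟩ := hS n t ht
  refine mem_iUnion₂.2 ⟨s, hs, ?_⟩
  rw [Metric.mem_closedBall, pow_succ] at *
  linarith [dist_triangle y t s]

theorem exists_two_mul_half_pow_lt {ε : ℝ} (hε : 0 < ε) : ∃ n : ℕ, 2 * (1 / 2 : ℝ) ^ n < ε := by
  obtain ⟨n, hn⟩ := exists_pow_lt_of_lt_one (half_pos hε) (by norm_num : (1 / 2 : ℝ) < 1)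
  exact ⟨n, by linarith⟩

/-- Up to finitely many terms, the sequence lies in finitely many small balls, so its range is
totally bounded. This one fact supplies non-emptiness and compactness of the limit values, and upper
semi-continuity through `exists_ballHull_subset`. -/
theorem exists_tendsto_subseq_ballHull [CompleteSpace Y] {S : ℕ → Set Y} (hfin : ∀ n, (S n).Finite)
    (hS : ∀ n, ∀ y ∈ S (n + 1), ∃ s ∈ S n, dist y s ≤ (1 / 2) ^ n) {y : ℕ → Y}
    (hy : ∀ n, y n ∈ ballHull S n) :
    ∃ z ∈ ⋂ n, ballHull S n, ∃ φ : ℕ → ℕ, StrictMono φ ∧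
      Filter.Tendsto (y ∘ φ) Filter.atTop (𝓝 z) := by
  have hanti := antitone_ballHull hS
  have htb : TotallyBounded (range y) := by
    refine Metric.totallyBounded_iff.2 fun ε hε => ?_
    obtain ⟨n, hn⟩ := exists_two_mul_half_pow_lt hε
    refine ⟨S n ∪ y '' Iio n, (hfin n).union ((finite_Iio n).image y), ?_⟩
    rintro _ ⟨k, rfl⟩
    rcases lt_or_ge k n with hk | hk
    · exact mem_biUnion (Or.inr ⟨k, hk, rfl⟩) (Metric.mem_ball_self hε)
    · obtain ⟨s, hs, hys⟩ := mem_iUnion₂.1 (hanti hk (hy k))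
      exact mem_biUnion (Or.inl hs) (lt_of_le_of_lt hys hn)
  obtain ⟨z, -, φ, hφ, hz⟩ := (htb.closure.isCompact_of_isClosed isClosed_closure).tendsto_subseq
    fun n => subset_closure (mem_range_self n)
  refine ⟨z, mem_iInter.2 fun n => ?_, φ, hφ, hz⟩
  refine (isClosed_ballHull hfin n).mem_of_tendsto hz ?_
  filter_upwards [Filter.eventually_ge_atTop n] with k hk
  exact hanti (hk.trans (hφ.id_le k)) (hy _)

theorem isCompact_iInter_ballHull [CompleteSpace Y] {S : ℕ → Set Y} (hfin : ∀ n, (S n).Finite)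
    (hS : ∀ n, ∀ y ∈ S (n + 1), ∃ s ∈ S n, dist y s ≤ (1 / 2) ^ n) :
    IsCompact (⋂ n, ballHull S n) :=
  IsSeqCompact.isCompact fun _ hy =>
    exists_tendsto_subseq_ballHull hfin hS fun n => mem_iInter.1 (hy n) n

theorem exists_ballHull_subset [CompleteSpace Y] {S : ℕ → Set Y} (hfin : ∀ n, (S n).Finite)
    (hS : ∀ n, ∀ y ∈ S (n + 1), ∃ s ∈ S n, dist y s ≤ (1 / 2) ^ n) {G : Set Y} (hG : IsOpen G)
    (h : ⋂ n, ballHull S n ⊆ G) : ∃ n, ballHull S n ⊆ G := by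
  by_contra! hn
  choose y hy hyG using fun n => not_subset.1 (hn n)
  obtain ⟨z, hz, φ, -, hlim⟩ := exists_tendsto_subseq_ballHull hfin hS hy
  exact hG.isClosed_compl.mem_of_tendsto hlim (Filter.Eventually.of_forall fun n => hyG (φ n)) (h hz)

/-- Traces of balls of radius `1/(n+1)` centred in `D` form a base; the centres need not lie in `T`.
-/
theorem weight_le_of_dense_approx {τ : Cardinal.{u}} (hτ : ℵ₀ ≤ τ) {T D : Set Y} (hD : #D ≤ τ)
    (hT : ∀ y ∈ T, ∀ ε > 0, ∃ d ∈ D, dist y d < ε) : weight T ≤ τ := by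
  let B : Set (Set T) := range fun q : D × ℕ =>
    (Subtype.val ⁻¹' Metric.ball (q.1 : Y) (1 / (q.2 + 1 : ℝ)) : Set T)
  have hB : TopologicalSpace.IsTopologicalBasis B := by
    refine TopologicalSpace.isTopologicalBasis_of_isOpen_of_nhds ?_ fun a s has hs => ?_
    · rintro _ ⟨q, rfl⟩
      exact Metric.isOpen_ball.preimage continuous_subtype_val
    · obtain ⟨ε, hε, hεs⟩ := Metric.isOpen_iff.1 hs a has
      obtain ⟨n, hn⟩ := exists_nat_one_div_lt (half_pos hε)
      obtain ⟨d, hd, had⟩ := hT a a.2 (1 / (n + 1 : ℝ)) Nat.one_div_pos_of_nat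
      refine ⟨_, ⟨(⟨d, hd⟩, n), rfl⟩, had, fun b hb => hεs ?_⟩
      have hb' : dist (b : Y) d < 1 / (n + 1 : ℝ) := hb
      rw [Metric.mem_ball, Subtype.dist_eq]
      linarith [dist_triangle_right (b : Y) a d]
  have hw : weight T ≤ #B := csInf_le' ⟨B, hB, rfl⟩
  refine hw.trans ?_
  calc #B ≤ #(D × ℕ) := Cardinal.mk_range_le
    _ = #D * ℵ₀ := by simp
    _ ≤ τ * τ := mul_le_mul' hD hτ
    _ = τ := Cardinal.mul_eq_self hτ

end Limit

/-! ### Construction of the compact-valued selection -/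

section Selection

variable {X : Type u} [TopologicalSpace X] [T2Space X] [ParacompactSpace X]
  {Y : Type u} [MetricSpace Y]

/-- For each `z` pick `y z ∈ m z` and `y' z ∈ θ z` at distance less than `δ`. The points whose
`m`-value contains `y z` and whose `θ`-value meets the `ε`-ball at `y' z` form an open set around
`z`; an approximation for this cover is pushed forward along `y'`. -/
theorem exists_isApproximation_close {τ : Cardinal.{u}}
    (hl : lindelofNumber (cozeroDimKernel X) ≤ τ) {θ : X → Set Y} (hθ : LowerHemicontinuous θ)
    {m : X → Set Y} (hm : ∀ y, IsOpen {x | y ∈ m x}) {δ ε : ℝ} (hε : 0 < ε)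
    (hδ : ∀ x, ∃ y ∈ m x, (θ x ∩ Metric.ball y δ).Nonempty) {O : Set X} (hO : IsOpen O)
    (hCO : cozeroDimKernel X ⊆ O) :
    ∃ (m' p' : X → Set Y) (H : Set X), IsApproximation τ m' p' H ∧ H ⊆ O ∧
      ∀ x, ∀ y' ∈ p' x, (θ x ∩ Metric.ball y' ε).Nonempty ∧ ∃ y ∈ m x, dist y' y ≤ δ := by
  choose y hy y' hy'θ hy'y using hδ
  have hθ' := (lowerHemicontinuous_iff_invImage θ).1 hθ
  obtain ⟨m', p', H, h, hHO, hp'⟩ := exists_isApproximation_of_cover hl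
    (U := fun z => {x | y z ∈ m x} ∩ invImage θ (Metric.ball (y' z) ε))
    (fun z => (hm _).inter (hθ' _ Metric.isOpen_ball))
    (eq_univ_of_forall fun z => mem_iUnion.2 ⟨z, hy z, y' z, hy'θ z, Metric.mem_ball_self hε⟩)
    hO hCO
  refine ⟨_, _, H, h.image y', hHO, ?_⟩
  rintro x _ ⟨z, hz, rfl⟩
  obtain ⟨h1, h2⟩ := hp' x z hz
  exact ⟨h2, y z, h1, (Metric.mem_ball.1 (hy'y z)).le⟩

theorem exists_selection_of_lindelofNumber_le {τ : Cardinal.{u}} (hτ : ℵ₀ ≤ τ)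
    (hl : lindelofNumber (cozeroDimKernel X) ≤ τ) [CompleteSpace Y] {θ : X → Set Y}
    (hne : IsSetValuedMapping θ) (hθ : LowerHemicontinuous θ) (hcl : ∀ x, IsClosed (θ x)) :
    ∃ (ψ : X → Set Y) (H : Set X),
      IsSelection ψ θ ∧ UpperHemicontinuous ψ ∧ (∀ x, IsCompact (ψ x)) ∧
      IsClosed H ∧ IsGδ H ∧ cozeroDimKernel X ⊆ H ∧
      weight (setImage ψ H) ≤ τ ∧ ∀ x, x ∉ H → ∃ y, ψ x = {y} := by
  let T : ℕ → Type u := fun n => {t : (X → Set Y) × (X → Set Y) × Set X //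
    IsApproximation τ t.1 t.2.1 t.2.2 ∧
      ∀ x, ∀ y ∈ t.2.1 x, (θ x ∩ Metric.ball y ((1 / 2) ^ n)).Nonempty}
  have start : Nonempty (T 0) := by
    -- With `m` constantly the whole space any positive `δ` will do; only closeness to `θ` is kept.
    obtain ⟨m, p, H, h, -, hp⟩ := exists_isApproximation_close hl hθ (m := fun _ => univ)
      (fun _ => by simp) (δ := 1) (ε := (1 / 2) ^ 0) (by simp)
      (fun x => (hne x).imp fun y hy => ⟨mem_univ y, y, hy, Metric.mem_ball_self one_pos⟩)
      isOpen_univ (subset_univ _)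
    exact ⟨⟨(m, p, H), h, fun x y hy => (hp x y hy).1⟩⟩
  have step : ∀ n (t : T n), ∃ t' : T (n + 1), t'.1.2.2 ⊆ t.1.2.2 ∧
      ∀ x, ∀ y' ∈ t'.1.2.1 x, ∃ y ∈ t.1.2.1 x, dist y' y ≤ (1 / 2) ^ n := by
    rintro n ⟨⟨m, p, H⟩, h, hp⟩
    obtain ⟨m', p', H', h', hH', hp'⟩ := exists_isApproximation_close hl hθ h.isOpen_fiber
      (δ := (1 / 2) ^ n) (ε := (1 / 2) ^ (n + 1)) (by positivity)
      (fun x => (h.nonempty x).imp fun y hy => ⟨hy, hp x y (h.subset x hy)⟩)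
      h.isClopen.isOpen h.kernel_subset
    refine ⟨⟨(m', p', H'), h', fun x y hy => (hp' x y hy).1⟩, hH', fun x y' hy' => ?_⟩
    obtain ⟨y, hy, hd⟩ := (hp' x y' hy').2
    exact ⟨y, h.subset x hy, hd⟩
  choose nxt hnxtH hnxtd using step
  let t : ∀ n, T n := fun n => Nat.rec start.some nxt n
  let H : ℕ → Set X := fun n => (t n).1.2.2
  let p : X → ℕ → Set Y := fun x n => (t n).1.2.1 x
  have happ : ∀ n, IsApproximation τ (t n).1.1 (t n).1.2.1 (t n).1.2.2 := fun n => (t n).2.1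
  have hpθ : ∀ n x, ∀ y ∈ p x n, (θ x ∩ Metric.ball y ((1 / 2) ^ n)).Nonempty :=
    fun n => (t n).2.2
  have hHanti : Antitone H := antitone_nat_of_succ_le fun n => hnxtH n (t n)
  have hS : ∀ x n, ∀ y ∈ p x (n + 1), ∃ s ∈ p x n, dist y s ≤ (1 / 2) ^ n :=
    fun x n => hnxtd n (t n) x
  have hfin : ∀ x n, (p x n).Finite := fun x n => (happ n).finite x
  have hpne : ∀ x n, (p x n).Nonempty := fun x n => ((happ n).nonempty x).mono ((happ n).subset x)
  have hψne : ∀ x, (⋂ n, ballHull (p x) n).Nonempty := fun x => by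
    choose y hy using hpne x
    obtain ⟨z, hz, -⟩ := exists_tendsto_subseq_ballHull (hfin x) (hS x)
      fun n => mem_iUnion₂.2 ⟨y n, hy n, Metric.mem_closedBall_self (by positivity)⟩
    exact ⟨z, hz⟩
  have hclose : ∀ x, ∀ y ∈ ⋂ n, ballHull (p x) n, ∀ n, ∃ s ∈ p x n, dist y s ≤ 2 * (1 / 2) ^ n :=
    fun x y hy n => by simpa [ballHull] using mem_iInter.1 hy n
  refine ⟨fun x => ⋂ n, ballHull (p x) n, ⋂ n, H n, ⟨hψne, fun x y hy => ?_⟩, ?_,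
    fun x => isCompact_iInter_ballHull (hfin x) (hS x),
    isClosed_iInter fun n => (happ n).isClopen.isClosed,
    IsGδ.iInter_of_isOpen fun n => (happ n).isClopen.isOpen,
    subset_iInter fun n => (happ n).kernel_subset, ?_, fun x hx => ?_⟩
  · rw [← (hcl x).closure_eq, Metric.mem_closure_iff]
    intro ε hε
    obtain ⟨n, hn⟩ := exists_two_mul_half_pow_lt (half_pos hε)
    obtain ⟨s, hs, hys⟩ := hclose x y hy n
    obtain ⟨z, hz, hzs⟩ := hpθ n x s hs
    refine ⟨z, hz, ?_⟩
    rw [Metric.mem_ball] at hzs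
    have : (0 : ℝ) < (1 / 2) ^ n := by positivity
    linarith [dist_triangle_right y z s]
  · refine upperHemicontinuous_iff_forall_isOpen.2 fun x G hG hxG => ?_
    obtain ⟨n, hn⟩ := exists_ballHull_subset (hfin x) (hS x) hG hxG
    filter_upwards [(happ n).eventually_subset x] with x' hx'
    exact (iInter_subset _ n).trans ((biUnion_subset_biUnion_left hx').trans hn)
  -- The values of all `p x n` with `x ∈ H n` approximate `ψ(H)`, and there are at most `ℵ₀ * τ` of
  -- them.
  · refine weight_le_of_dense_approx hτ (D := ⋃ n : ULift.{u} ℕ, ⋃ x ∈ H n.down, p x n.down) ?_ ?_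
    · calc _ ≤ #(ULift.{u} ℕ) * ⨆ n : ULift.{u} ℕ, #(⋃ x ∈ H n.down, p x n.down : Set Y) :=
            Cardinal.mk_iUnion_le _
        _ ≤ τ * τ := mul_le_mul' (by simpa using hτ) (ciSup_le' fun n => (happ n.down).mk_le)
        _ = τ := Cardinal.mul_eq_self hτ
    · intro y hy ε hε
      obtain ⟨x, hx, hyx⟩ := mem_iUnion₂.1 hy
      obtain ⟨n, hn⟩ := exists_two_mul_half_pow_lt hε
      obtain ⟨s, hs, hys⟩ := hclose x y hyx n
      exact ⟨s, mem_iUnion.2 ⟨⟨n⟩, mem_biUnion (mem_iInter.1 hx n) hs⟩, hys.trans_lt hn⟩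
  · obtain ⟨k, hk⟩ : ∃ k, x ∉ H k := by simpa using hx
    obtain ⟨y, hy⟩ := hψne x
    refine ⟨y, (subset_singleton_iff.2 fun z hz => eq_of_forall_dist_le fun ε hε => ?_).antisymm
      (singleton_subset_iff.2 hy)⟩
    obtain ⟨n, hn⟩ := exists_two_mul_half_pow_lt (half_pos hε)
    -- Stage `max k n` is late enough both for `p x` to be a singleton and for its radius to be
    -- below `ε / 2`.
    obtain ⟨w, hw⟩ := (happ (max k n)).singleton x fun h => hk (hHanti (le_max_left k n) h)
    obtain ⟨s, hs, hys⟩ := hclose x y hy (max k n)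
    obtain ⟨s', hs', hzs'⟩ := hclose x z hz (max k n)
    have hsw : s = w := by simpa [p, hw] using hs
    have hsw' : s' = w := by simpa [p, hw] using hs'
    subst hsw hsw'
    have : (1 / 2 : ℝ) ^ max k n ≤ (1 / 2) ^ n :=
      pow_le_pow_of_le_one (by norm_num) (by norm_num) (le_max_right k n)
    linarith [dist_triangle_right z y s']

end Selection

/-! ### Weights of largest images -/

section LargestImage

theorem exists_isTopologicalBasis_mk_eq_weight (Z : Type u) [TopologicalSpace Z] :
    ∃ B : Set (Set Z), TopologicalSpace.IsTopologicalBasis B ∧ #B = weight Z :=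
  csInf_mem (s := {κ | ∃ B : Set (Set Z), TopologicalSpace.IsTopologicalBasis B ∧ #B = κ})
    ⟨_, _, TopologicalSpace.isTopologicalBasis_opens, rfl⟩

theorem weight_mono {Y : Type u} [TopologicalSpace Y] {S T : Set Y} (h : S ⊆ T) :
    weight S ≤ weight T := by
  obtain ⟨B, hB, hcard⟩ := exists_isTopologicalBasis_mk_eq_weight T
  have hw : weight S ≤ #(preimage (inclusion h) '' B) :=
    csInf_le' ⟨_, hB.isInducing (IsEmbedding.inclusion h).isInducing, rfl⟩
  exact hw.trans (Cardinal.mk_image_le.trans hcard.le)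

theorem mk_le_weight (Z : Type u) [TopologicalSpace Z] [DiscreteTopology Z] : #Z ≤ weight Z := by
  obtain ⟨B, hB, hcard⟩ := exists_isTopologicalBasis_mk_eq_weight Z
  have hmem : ∀ z : Z, {z} ∈ B := fun z => by
    obtain ⟨s, hs, hzs, hsz⟩ := hB.exists_subset_of_mem_open (mem_singleton z) (isOpen_discrete _)
    rwa [← hsz.antisymm (singleton_subset_iff.2 hzs)]
  rw [← hcard]
  exact Cardinal.mk_le_of_injective (f := fun z : Z => (⟨{z}, hmem z⟩ : B))
    fun a b hab => singleton_injective (congrArg Subtype.val hab)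

variable {X : Type u} {Y : Type u} {ψ : X → Set Y}

theorem largestImage_subset {D : Set Y} {x : X} (hx : ψ x ⊆ D)
    (hD : ∀ z, (ψ z ∩ D).Nonempty → ψ z ⊆ D) : largestImage ψ {x} ⊆ D := by
  refine iUnion_subset fun n => ?_
  induction n with
  | zero => simpa [iterImage, setImage] using hx
  | succ n ih => exact iUnion₂_subset fun z hz => hD z (hz.mono (inter_subset_inter_right _ ih))

/-- A value off `H` is a point, so it lies in `ψ(H)` as soon as it meets it: `ψ(H)` absorbs largest
images. If `ψ x` is not contained in `ψ(H)`, then `ψ x = {y}`, and any other value containing `y` is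
also `{y}`. -/
theorem weight_largestImage_le [MetricSpace Y] {τ : Cardinal.{u}} (hτ : ℵ₀ ≤ τ) {H : Set X}
    (hw : weight (setImage ψ H) ≤ τ) (hH : ∀ x, x ∉ H → ∃ y, ψ x = {y}) (x : X) :
    weight (largestImage ψ {x}) ≤ τ := by
  have hHD : ∀ z ∈ H, ψ z ⊆ setImage ψ H := fun z hz => subset_biUnion_of_mem hz
  have hD : ∀ z, (ψ z ∩ setImage ψ H).Nonempty → ψ z ⊆ setImage ψ H := fun z hz => by
    by_cases hzH : z ∈ H
    · exact hHD z hzH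
    · obtain ⟨y, hy⟩ := hH z hzH
      rw [hy] at hz ⊢
      exact singleton_subset_iff.2 (singleton_inter_nonempty.1 hz)
  by_cases hx : ψ x ⊆ setImage ψ H
  · exact (weight_mono (largestImage_subset hx hD)).trans hw
  obtain ⟨y, hy⟩ := hH x fun h => hx (hHD x h)
  have hsub : largestImage ψ {x} ⊆ {y} := largestImage_subset hy.subset fun z hz => by
    rw [inter_singleton_nonempty] at hz
    have hzH : z ∉ H := fun h => hx (hy ▸ singleton_subset_iff.2 (hHD z h hz))
    obtain ⟨w, hw⟩ := hH z hzH
    rw [hw] at hz ⊢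
    exact (singleton_subset_iff.2 hz.symm)
  refine weight_le_of_dense_approx hτ (D := {y}) ?_ fun z hz ε hε => ⟨y, rfl, ?_⟩
  · simpa using Cardinal.one_le_aleph0.trans hτ
  · rw [mem_singleton_iff.1 (hsub hz), dist_self]
    exact hε

end LargestImage

/-! ### Consequences of discrete selections -/

section DiscreteSelections

variable {X : Type u} [TopologicalSpace X]

/-- Every lower semi-continuous mapping into a discrete space has an upper semi-continuous selection
whose largest images of points have cardinality at most `τ`. -/
def HasDiscreteSelections (X : Type u) [TopologicalSpace X] (τ : Cardinal.{u}) : Prop :=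
  ∀ (Y : Type u) [TopologicalSpace Y] [DiscreteTopology Y] (θ : X → Set Y),
    IsSetValuedMapping θ → LowerHemicontinuous θ →
    ∃ ψ : X → Set Y, IsSelection ψ θ ∧ UpperHemicontinuous ψ ∧ ∀ x, #(largestImage ψ {x}) ≤ τ

theorem lowerHemicontinuous_of_isOpen_fiber {Y : Type v} [TopologicalSpace Y] {θ : X → Set Y}
    (h : ∀ y, IsOpen {x | y ∈ θ x}) : LowerHemicontinuous θ := by
  refine (lowerHemicontinuous_iff_invImage θ).2 fun G _ => ?_
  have : invImage θ G = ⋃ y ∈ G, {x | y ∈ θ x} := by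
    ext x; simp [invImage, Set.Nonempty, and_comm]
  rw [this]
  exact isOpen_biUnion fun y _ => h y

namespace HasDiscreteSelections

variable {τ : Cardinal.{u}}

/-- The discrete form of the selection property, stated through open and closed fibres. -/
theorem exists_selection (h : HasDiscreteSelections X τ) {Y : Type u} {θ : X → Set Y}
    (hne : IsSetValuedMapping θ) (hθ : ∀ y, IsOpen {x | y ∈ θ x}) :
    ∃ ψ : X → Set Y, IsSelection ψ θ ∧ (∀ B, IsClosed (invImage ψ B)) ∧
      ∀ x, #(largestImage ψ {x}) ≤ τ := by
  let : TopologicalSpace Y := ⊥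
  have : DiscreteTopology Y := ⟨rfl⟩
  obtain ⟨ψ, h1, h2, h3⟩ := h Y θ hne (lowerHemicontinuous_of_isOpen_fiber hθ)
  exact ⟨ψ, h1, fun B => (upperHemicontinuous_iff_invImage ψ).1 h2 B (isClosed_discrete B), h3⟩

/-- Select from `x ↦ {i | x ∈ U i}`: a union of fibres of `ψ` over `B` is the inverse image of the
closed set `B`. -/
theorem hasClosurePreservingShrinking (h : HasDiscreteSelections X τ) :
    HasClosurePreservingShrinking X := by
  intro ι U hU hcov
  obtain ⟨ψ, hψ, hcl, -⟩ := h.exists_selection (θ := fun x => {i | x ∈ U i})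
    (fun x => mem_iUnion.1 (hcov.symm ▸ mem_univ x)) hU
  refine ⟨fun i => {x | i ∈ ψ x}, fun B => ?_, eq_univ_of_forall fun x => ?_, fun i x hx => ?_⟩
  · have : ⋃ i ∈ B, {x | i ∈ ψ x} = invImage ψ B := by
      ext x; simp [invImage, Set.Nonempty, and_comm]
    exact this ▸ hcl B
  · exact mem_iUnion.2 (hψ.1 x)
  · exact hψ.2 x hx

theorem mk_setOf_inter_cozeroDimKernel_le [T1Space X] (h : HasDiscreteSelections X τ) {ι : Type u}
    {V : ι → Set X} (hV : ∀ i, IsOpen (V i))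
    (hd : ∀ x, ∃ N ∈ 𝓝 x, {i | (V i ∩ N).Nonempty}.Subsingleton) :
    #{i | (V i ∩ cozeroDimKernel X).Nonempty} ≤ τ := by
  have := h.hasClosurePreservingShrinking.normalSpace
  let S := {i | (V i ∩ cozeroDimKernel X).Nonempty}
  have hW : ∀ s : S, ∃ W ⊆ V s, IsOpen W ∧ ∃ B ⊆ W, IsClosed B ∧
      ∀ K : Set X, IsClopen K → B ⊆ K → ¬ K ⊆ W := by
    rintro ⟨i, x, hxV, hxC⟩
    by_contra! hn
    refine hxC (mem_zeroDimPart_of_clopenSeparates (hV i) hxV fun W hWV hWo B hB hBW => ?_)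
    exact hn W hWV hWo B hBW hB
  choose W hWV hWo B hBW hBc hK using hW
  have hdisj : ∀ s t x, x ∈ W s → x ∈ W t → s = t := fun s t x hs ht => by
    obtain ⟨N, hN, hsub⟩ := hd x
    exact Subtype.ext (hsub ⟨x, hWV s hs, mem_of_mem_nhds hN⟩ ⟨x, hWV t ht, mem_of_mem_nhds hN⟩)
  have hlf : LocallyFinite B := fun x => by
    obtain ⟨N, hN, hsub⟩ := hd x
    refine ⟨N, hN, Subsingleton.finite fun s hs t ht => Subtype.ext (hsub ?_ ?_)⟩
    · exact hs.mono (inter_subset_inter_left _ ((hBW s).trans (hWV s)))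
    · exact ht.mono (inter_subset_inter_left _ ((hBW t).trans (hWV t)))
  -- On `B s` the only available value is `some s`, outside all `W s` only `none`; the gaps `W s \ B
  -- s` allow both.
  let θ : X → Set (Option S) := fun x => {y | y.elim (x ∉ ⋃ s, B s) fun s => x ∈ W s}
  obtain ⟨ψ, hψ, hcl, hcard⟩ := h.exists_selection (θ := θ)
    (fun x => by
      by_cases hx : x ∈ ⋃ s, B s
      · obtain ⟨s, hs⟩ := mem_iUnion.1 hx
        exact ⟨some s, hBW s hs⟩
      · exact ⟨none, hx⟩)
    (by
      rintro (_ | s)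
      · exact (hlf.isClosed_iUnion hBc).isOpen_compl
      · exact hWo s)
  have hsome : ∀ {x s}, some s ∈ ψ x → x ∈ W s := fun {x s} hx => hψ.2 x hx
  have hnone : ∀ {x}, none ∈ ψ x → x ∉ ⋃ s, B s := fun {x} hx => hψ.2 x hx
  -- Were the two values never taken together, the fibre of `ψ` over `some s` would be a clopen set
  -- between `B s` and `W s`.
  have hlink : ∀ s, ∃ x, none ∈ ψ x ∧ some s ∈ ψ x := fun s => by
    by_contra! hn
    refine hK s (invImage ψ {some s}) ⟨hcl _, ?_⟩ (fun x hx => ?_) (fun x hx => ?_)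
    · have : (invImage ψ {some s})ᶜ = invImage ψ {some s}ᶜ := by
        ext x
        constructor
        · intro hx
          obtain ⟨y, hy⟩ := hψ.1 x
          refine ⟨y, hy, fun hys => hx ⟨y, hy, hys⟩⟩
        · rintro ⟨y, hy, hys⟩ ⟨_, hs, rfl⟩
          rcases y with _ | t
          · exact hn x hy hs
          · exact hys (congrArg some (hdisj t s x (hsome hy) (hsome hs)))
      rw [← isClosed_compl_iff, this]
      exact hcl _
    · obtain ⟨y, hy⟩ := hψ.1 x
      rcases y with _ | t
      · exact (hnone hy (mem_iUnion.2 ⟨s, hx⟩)).elim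
      · exact ⟨some t, hy, congrArg some (hdisj t s x (hsome hy) (hBW s hx))⟩
    · obtain ⟨_, hs, rfl⟩ := hx
      exact hsome hs
  change #S ≤ τ
  rcases isEmpty_or_nonempty S with hS | ⟨⟨s₀⟩⟩
  · simp
  obtain ⟨x₀, hx₀, -⟩ := hlink s₀
  have hmem : ∀ s, some s ∈ largestImage ψ {x₀} := fun s => by
    obtain ⟨x, hx, hxs⟩ := hlink s
    -- Index `1` is the second image: from `x₀` to `none`, then to `some s`.
    exact mem_iUnion.2 ⟨1, mem_iUnion₂.2 ⟨x, ⟨none, hx, mem_iUnion₂.2 ⟨x₀, rfl, hx₀⟩⟩, hxs⟩⟩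
  exact (Cardinal.mk_le_of_injective (f := fun s => (⟨some s, hmem s⟩ : largestImage ψ {x₀}))
    fun s t hst => Option.some_injective _ (congrArg Subtype.val hst)).trans (hcard x₀)

/-- Extend the cover to `X`, with the complement of the kernel as the member `none`. Each of the
countably many discrete layers of a refinement has at most `τ` sets meeting the kernel, and none of
these comes from `none`. -/
theorem lindelofNumber_cozeroDimKernel_le [T1Space X] (hτ : ℵ₀ ≤ τ)
    (h : HasDiscreteSelections X τ) : lindelofNumber (cozeroDimKernel X) ≤ τ := by
  refine csInf_le' fun 𝒰 ⟨hUo, hUc⟩ => ?_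
  choose O hO hOU using fun U : 𝒰 => isOpen_induced_iff.1 (hUo U.1 U.2)
  let P : Option 𝒰 → Set X := fun i => i.elim (cozeroDimKernel X)ᶜ O
  obtain ⟨V, hV, hVP, hd, -, hVc⟩ :=
    h.hasClosurePreservingShrinking.exists_sigma_discrete_refinement P
      (by rintro (_ | U); exacts [isClosed_cozeroDimKernel.isOpen_compl, hO U])
      (eq_univ_of_forall fun x => by
        by_cases hx : x ∈ cozeroDimKernel X
        · obtain ⟨U, hU, hxU⟩ : (⟨x, hx⟩ : cozeroDimKernel X) ∈ ⋃₀ 𝒰 := hUc ▸ mem_univ _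
          refine mem_iUnion.2 ⟨some ⟨U, hU⟩, ?_⟩
          have : (⟨x, hx⟩ : cozeroDimKernel X) ∈ Subtype.val ⁻¹' O ⟨U, hU⟩ :=
            (hOU ⟨U, hU⟩).symm ▸ hxU
          exact this
        · exact mem_iUnion.2 ⟨none, hx⟩)
  refine ⟨⋃ n : ULift.{u} ℕ, (fun i => (Subtype.val ⁻¹' V n.down i : Set (cozeroDimKernel X))) ''
    {i | (V n.down i ∩ cozeroDimKernel X).Nonempty}, ⟨?_, eq_univ_of_forall fun x => ?_⟩, ?_, ?_⟩
  · intro s hs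
    obtain ⟨n, i, -, rfl⟩ := mem_iUnion.1 hs
    exact (hV _ _).preimage continuous_subtype_val
  · obtain ⟨n, i, hx⟩ := hVc x
    exact ⟨_, mem_iUnion.2 ⟨⟨n⟩, i, ⟨x, hx, x.2⟩, rfl⟩, hx⟩
  · intro s hs
    obtain ⟨n, i, ⟨x, hxV, hxC⟩, rfl⟩ := mem_iUnion.1 hs
    rcases i with _ | U
    · exact (hVP _ _ hxV hxC).elim
    · refine ⟨U.1, U.2, ?_⟩
      rw [← hOU U]
      exact preimage_mono (hVP _ _)
  · calc _ ≤ #(ULift.{u} ℕ) * ⨆ n : ULift.{u} ℕ, #((fun i => (Subtype.val ⁻¹' V n.down i :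
            Set (cozeroDimKernel X))) '' {i | (V n.down i ∩ cozeroDimKernel X).Nonempty}) :=
          Cardinal.mk_iUnion_le _
      _ ≤ τ * τ := mul_le_mul' (by simpa using hτ) (ciSup_le' fun n =>
          Cardinal.mk_image_le.trans (h.mk_setOf_inter_cozeroDimKernel_le (hV _) (hd _)))
      _ = τ := Cardinal.mul_eq_self hτ

end HasDiscreteSelections

end DiscreteSelections

end SelectionTheory

/-! ### Discrete spaces as complete metric spaces, and the equivalence -/

theorem SelectionTheory.isCompletelyMetrizableSpace_of_discrete (Y : Type u)
    [t : TopologicalSpace Y] [hY : DiscreteTopology Y] :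
    TopologicalSpace.IsCompletelyMetrizableSpace Y := by
  obtain rfl := hY.eq_bot
  let : UniformSpace Y := ⊥
  infer_instance

theorem corollary3p4 {X : Type u} [TopologicalSpace X] [T1Space X]
    (τ : Cardinal.{u}) (hτ : ℵ₀ ≤ τ) :
    List.TFAE [
      -- `X` is paracompact (Hausdorff) and `l(cω(X)) ≤ τ`
      (T2Space X ∧ ParacompactSpace X) ∧
        SelectionTheory.lindelofNumber (SelectionTheory.cozeroDimKernel X) ≤ τ,
      ∀ (Y : Type u) [MetricSpace Y] [CompleteSpace Y] (θ : X → Set Y),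
        SelectionTheory.IsSetValuedMapping θ → LowerHemicontinuous θ →
        (∀ x, IsClosed (θ x)) →
        ∃ (ψ : X → Set Y) (H : Set X),
          SelectionTheory.IsSelection ψ θ ∧ UpperHemicontinuous ψ ∧ (∀ x, IsCompact (ψ x)) ∧
          IsClosed H ∧ IsGδ H ∧ SelectionTheory.cozeroDimKernel X ⊆ H ∧
          SelectionTheory.weight (SelectionTheory.setImage ψ H) ≤ τ ∧
          ∀ x, x ∉ H → ∃ y, ψ x = {y},
      ∀ (Y : Type u) [MetricSpace Y] [CompleteSpace Y] (θ : X → Set Y),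
        SelectionTheory.IsSetValuedMapping θ → LowerHemicontinuous θ →
        (∀ x, IsClosed (θ x)) →
        ∃ ψ : X → Set Y,
          SelectionTheory.IsSelection ψ θ ∧ UpperHemicontinuous ψ ∧ (∀ x, IsCompact (ψ x)) ∧
          ∀ x, SelectionTheory.weight (SelectionTheory.largestImage ψ {x}) ≤ τ,
      ∀ (Y : Type u) [TopologicalSpace Y] [DiscreteTopology Y] (θ : X → Set Y),
        SelectionTheory.IsSetValuedMapping θ → LowerHemicontinuous θ →
        ∃ ψ : X → Set Y,
          SelectionTheory.IsSelection ψ θ ∧ UpperHemicontinuous ψ ∧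
          ∀ x, #(SelectionTheory.largestImage ψ {x}) ≤ τ] := by

  tfae_have 1 → 2 := by
    rintro ⟨⟨_, _⟩, hl⟩ Y _ _ θ hne hθ hcl
    exact SelectionTheory.exists_selection_of_lindelofNumber_le hτ hl hne hθ hcl
  tfae_have 2 → 3 := by
    intro h Y _ _ θ hne hθ hcl
    obtain ⟨ψ, H, hψ, husc, hcomp, -, -, -, hw, hH⟩ := h Y θ hne hθ hcl
    exact ⟨ψ, hψ, husc, hcomp, SelectionTheory.weight_largestImage_le hτ hw hH⟩
  tfae_have 3 → 4 := by
    intro h Y _ _ θ hne hθ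
    have := SelectionTheory.isCompletelyMetrizableSpace_of_discrete Y
    let := TopologicalSpace.upgradeIsCompletelyMetrizable Y
    obtain ⟨ψ, hψ, husc, -, hw⟩ := h Y θ hne hθ fun x => isClosed_discrete _
    exact ⟨ψ, hψ, husc, fun x => (SelectionTheory.mk_le_weight _).trans (hw x)⟩
  tfae_have 4 → 1 := by
    intro h
    replace h : SelectionTheory.HasDiscreteSelections X τ := h
    have hcp := h.hasClosurePreservingShrinking
    have := hcp.normalSpace
    exact ⟨⟨inferInstance, hcp.paracompactSpace⟩, h.lindelofNumber_cozeroDimKernel_le hτ⟩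
  tfae_finish
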